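/- Consider the first-order FIR system with binary-valued observations $$y_k=\phi_k\theta+d_k,\qquad s_k=I_{\{y_k\le C\}},\qquad k\ge 1,$$ with unknown constant $\theta\in\mathbb R$, known threshold $C\in\mathbb R$ and deterministic inputs $\phi_k\in\mathbb R$. Assume: (1) $|\theta|\le\bar\theta$, where $\bar\theta$ is known; (2) $(d_k)_{k\ge1}$ is an i.i.d. sequence of normal random variables with mean $0$ and known variance $\sigma^2>0$; denote their distribution function by $F$ and their density by $f$; (3) $\bar\phi:=\sup_{k\ge1}|\phi_k|<\infty$, and there are an integer $N\ge1$ and a $\delta>0$ such that $\frac1N\sum_{i=k}^{k+N-1}\phi_i^2\ge\delta^2$ for all $k\ge1$. Let $M=\bar\phi\bar\theta+2$. The IMPF algorithm starts from an arbitrary $\hat\theta_0\in\mathbb R$ and an arbitrary $\hat P_0>0$ and computes, for $k\ge1$, $$z_k=\max\{-M,\min\{M,\phi_k\hat\theta_{k-1}\}\},\qquad \gamma_k=\begin{cases}1,&|\phi_k\hat\theta_{k-1}|\le M,\\ |\phi_k\hat\theta_{k-1}|,&|\phi_k\hat\theta_{k-1}|>M,\end{cases}$$ $$\hat F_k=F(C-z_k),\quad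 \hat f_k=f(C-z_k),\quad \hat\alpha_k=\frac{\hat f_k}{\hat F_k(1-\hat F_k)},\quad \hat\beta_k=\frac{\hat f_k^2}{\hat F_k(1-\hat F_k)},$$ $$\hat P_k=\hat P_{k-1}-\frac{\hat\beta_k\hat P_{k-1}^2\phi_k^2}{1+\hat\beta_k\phi_k^2\hat P_{k-1}},\qquad \hat\theta_k=\hat\theta_{k-1}+\hat P_k\phi_k\gamma_k\hat\alpha_k(\hat F_k-s_k).$$ Let $\tilde\theta_k=\hat\theta_k-\theta$. Then $E\tilde\theta_k^2<\infty$ for every $k$, the algorithm converges in mean square, that is, $\lim_{k\to\infty}E\tilde\theta_k^2=0$, and $$E\tilde\theta_k^2=O\left(\frac1k\right)\quad\text{as }k\to\infty.$$ -/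

import Mathlib

open MeasureTheory ProbabilityTheory Filter Topology Asymptotics
open scoped NNReal

noncomputable section

namespace IMPF

/-- Distribution function `F` of the centred normal noise with standard deviation `σ`. -/
def noiseCDF (σ : ℝ≥0) (x : ℝ) : ℝ := cdf (gaussianReal 0 (σ ^ 2)) x

/-- Density `f` of the centred normal noise with standard deviation `σ`. -/
def noisePDF (σ : ℝ≥0) (x : ℝ) : ℝ := gaussianPDFReal 0 (σ ^ 2) x

/-- Output `y_k = φ_k θ + d_k` of the first-order FIR system. -/
def output {Ω : Type*} (φ : ℕ → ℝ) (θ : ℝ) (d : ℕ → Ω → ℝ) (k : ℕ) (ω : Ω) : ℝ :=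
  φ k * θ + d k ω

open Classical in
/-- Binary-valued observation `s_k = I_{y_k ≤ C}`. -/
def observation {Ω : Type*} (C : ℝ) (φ : ℕ → ℝ) (θ : ℝ) (d : ℕ → Ω → ℝ)
    (k : ℕ) (ω : Ω) : ℝ :=
  if output φ θ d k ω ≤ C then 1 else 0

/-- The noise `d_k`, `k ≥ 1`, is i.i.d. normal with mean zero and variance `σ ^ 2`. -/
structure NoiseAssumption {Ω : Type*} [MeasurableSpace Ω] (μ : Measure Ω) (σ : ℝ≥0)
    (d : ℕ → Ω → ℝ) : Prop where
  indep : iIndepFun (fun k : ℕ => d (k + 1)) μ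
  law : ∀ k : ℕ, 1 ≤ k → HasLaw (d k) (gaussianReal 0 (σ ^ 2)) μ

/-- The (deterministic) input `φ_k`, `k ≥ 1`, is bounded and persistently exciting. -/
structure InputAssumption (φ : ℕ → ℝ) : Prop where
  bdd : BddAbove (Set.range fun k : ℕ => |φ (k + 1)|)
  excitation : ∃ N : ℕ, 1 ≤ N ∧ ∃ δ : ℝ, 0 < δ ∧
    ∀ k : ℕ, 1 ≤ k → δ ^ 2 ≤ (1 / (N : ℝ)) * ∑ i ∈ Finset.Ico k (k + N), φ i ^ 2

/-- `φ̄ = sup_{k ≥ 1} |φ_k|`. -/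
def inputSup (φ : ℕ → ℝ) : ℝ := ⨆ k : ℕ, |φ (k + 1)|

/-- The cut-off level `M = φ̄ θ̄ + 2`. -/
def cutoffLevel (φ : ℕ → ℝ) (θbar : ℝ) : ℝ := inputSup φ * θbar + 2

open Classical in
/-- The cut-off coefficient `z_k`, as a function of `x = φ_k θ̂_{k-1}`. -/
def cutoff (M x : ℝ) : ℝ := if M < x then M else if x < -M then -M else x

open Classical in
/-- The adaptive accelerated coefficient `γ_k`, as a function of `x = φ_k θ̂_{k-1}`. -/
def accel (M x : ℝ) : ℝ := if |x| ≤ M then 1 else |x|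

/-- The weight `α̂_k = f̂_k / (F̂_k (1 - F̂_k))`, as a function of `z = z_k`. -/
def alphaHat (σ : ℝ≥0) (C z : ℝ) : ℝ :=
  noisePDF σ (C - z) / (noiseCDF σ (C - z) * (1 - noiseCDF σ (C - z)))

/-- The weight `β̂_k = f̂_k² / (F̂_k (1 - F̂_k))`, as a function of `z = z_k`. -/
def betaHat (σ : ℝ≥0) (C z : ℝ) : ℝ :=
  noisePDF σ (C - z) ^ 2 / (noiseCDF σ (C - z) * (1 - noiseCDF σ (C - z)))

/-- The recursion `P̂_{k-1} ↦ P̂_k`, for the input `u = φ_k` and the weight `b = β̂_k`. -/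
def updateP (b u P : ℝ) : ℝ := P - b * P * u * u * P / (1 + b * u * P * u)

/-- The data carried by the algorithm: the estimate `θ̂_k` and the number `P̂_k`. -/
structure State where
  est : ℝ
  P : ℝ

/-- One step of the algorithm, from time `k-1` to time `k`, with input `u = φ_k` and
observation `s = s_k`. -/
def step (σ : ℝ≥0) (C M u s : ℝ) (S : State) : State :=
  let z := cutoff M (u * S.est)
  let γ := accel M (u * S.est)
  let P := updateP (betaHat σ C z) u S.P
  { est := S.est + P * u * γ * alphaHat σ C z * (noiseCDF σ (C - z) - s)
    P := P }

/-- The algorithm with input sequence `φ`, observation sequence `s` and initial values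
`θ̂_0 = θ₀`, `P̂_0 = P₀`. -/
def run (σ : ℝ≥0) (C M : ℝ) (φ s : ℕ → ℝ) (θ₀ P₀ : ℝ) : ℕ → State
  | 0 => { est := θ₀, P := P₀ }
  | k + 1 => step σ C M (φ (k + 1)) (s (k + 1)) (run σ C M φ s θ₀ P₀ k)

/-- The estimate `θ̂_k`, as a random variable, when the observations come from the system
with parameter `θ`, noise `d`, threshold `C`, and when `θbar` is the known bound on the
parameter. -/
def estimate {Ω : Type*} (σ : ℝ≥0) (C θbar : ℝ) (φ : ℕ → ℝ) (θ : ℝ) (d : ℕ → Ω → ℝ)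
    (θ₀ P₀ : ℝ) (k : ℕ) (ω : Ω) : ℝ :=
  (run σ C (cutoffLevel φ θbar) φ (fun j => observation C φ θ d j ω) θ₀ P₀ k).est

end IMPF

end

noncomputable section

/-! ### Regularity of the Gaussian distribution function and of the weights -/

namespace IMPF

/-! Let `X k` be the error at time `k`, `v k = φ (k + 1)`, `Q k` the reciprocal of `P̂_k`, and `A =
energy v`. In reciprocal form the gain recursion is additive, `Q (k + 1) = Q k + β k * v k ^ 2`, and
since the cut-off keeps `β` between positive constants, the random `Q` is comparable to the
deterministic `A`. The error moves by `v / Q` times a drift `m` plus a martingale difference. Two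
facts about the drift carry the proof: it pulls back at least linearly everywhere
(`exists_meanInnovation_mul_le`), and `v * m` equals `-β * v ^ 2 * X` up to a quadratic error
(`exists_linearization_bound`).

The global pull-back constant `c` may be too small compared with `Q / A` to give the rate `1 / A`
for the second moment directly. For the power `2 * n + 2`, however, the contraction is multiplied by
`n + 1`; a large `n` gives `E X ^ (2 * n + 2) = O(1 / A)` (`exists_energy_mul_moment_le`).

This crude high moment then feeds a sharp second-moment estimate. In the recursion for `Q * X` the
weight `β` cancels the linear part of the drift, leaving the quadratic remainder and the noise. The
cubic cross term is split between a small multiple of `(Q * X) ^ 2` and the controlled high moment,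
whence `E (Q * X) ^ 2 = O(A)` and `E X ^ 2 = O(1 / A)` (`exists_energy_mul_integral_sq_le`).
Persistent excitation makes `A` grow at least linearly. -/

lemma hasDerivAt_noiseCDF {σ : ℝ≥0} (hσ : 0 < σ) (x : ℝ) :
    HasDerivAt (noiseCDF σ) (noisePDF σ x) x := by
  have hv : σ ^ 2 ≠ 0 := pow_ne_zero _ hσ.ne'
  have hint : Integrable (noisePDF σ) := integrable_gaussianPDFReal _ _
  have hcdf : noiseCDF σ = fun y => ∫ t in Set.Iic y, noisePDF σ t := by
    ext y
    rw [noiseCDF, cdf_eq_real, measureReal_def, gaussianReal_apply_eq_integral _ hv,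
      ENNReal.toReal_ofReal (integral_nonneg fun t => gaussianPDFReal_nonneg _ _ t)]
    rfl
  have hsplit : noiseCDF σ = fun y => (∫ t in Set.Iic (0 : ℝ), noisePDF σ t) +
      ∫ t in (0 : ℝ)..y, noisePDF σ t := by
    ext y
    rw [hcdf, ← intervalIntegral.integral_Iic_sub_Iic hint.integrableOn hint.integrableOn]
    ring
  have hcont : Continuous (noisePDF σ) := by
    unfold noisePDF gaussianPDFReal
    fun_prop
  rw [hsplit]
  exact (intervalIntegral.integral_hasDerivAt_right hint.intervalIntegrable
    (hcont.stronglyMeasurableAtFilter _ _) hcont.continuousAt).const_add _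

lemma contDiff_noisePDF (σ : ℝ≥0) : ContDiff ℝ 1 (noisePDF σ) := by
  unfold noisePDF gaussianPDFReal
  fun_prop

lemma noisePDF_pos {σ : ℝ≥0} (hσ : 0 < σ) (x : ℝ) : 0 < noisePDF σ x :=
  gaussianPDFReal_pos _ _ _ (pow_ne_zero _ hσ.ne')

lemma continuous_noiseCDF {σ : ℝ≥0} (hσ : 0 < σ) : Continuous (noiseCDF σ) :=
  continuous_iff_continuousAt.2 fun x => (hasDerivAt_noiseCDF hσ x).continuousAt

lemma strictMono_noiseCDF {σ : ℝ≥0} (hσ : 0 < σ) : StrictMono (noiseCDF σ) :=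
  strictMono_of_deriv_pos fun x => by
    rw [(hasDerivAt_noiseCDF hσ x).deriv]
    exact noisePDF_pos hσ x

lemma noiseCDF_pos {σ : ℝ≥0} (hσ : 0 < σ) (x : ℝ) : 0 < noiseCDF σ x :=
  (cdf_nonneg _ (x - 1)).trans_lt (strictMono_noiseCDF hσ (sub_one_lt x))

lemma noiseCDF_lt_one {σ : ℝ≥0} (hσ : 0 < σ) (x : ℝ) : noiseCDF σ x < 1 :=
  (strictMono_noiseCDF hσ (lt_add_one x)).trans_le (cdf_le_one _ (x + 1))

lemma noiseVariance_pos {σ : ℝ≥0} (hσ : 0 < σ) (x : ℝ) :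
    0 < noiseCDF σ x * (1 - noiseCDF σ x) :=
  mul_pos (noiseCDF_pos hσ x) (sub_pos.2 (noiseCDF_lt_one hσ x))

lemma continuous_alphaHat {σ : ℝ≥0} (hσ : 0 < σ) (C : ℝ) : Continuous (alphaHat σ C) := by
  have h1 := continuous_noiseCDF hσ
  have h2 := (contDiff_noisePDF σ).continuous
  unfold alphaHat
  exact Continuous.div (by fun_prop) (by fun_prop) fun z => (noiseVariance_pos hσ _).ne'

lemma alphaHat_pos {σ : ℝ≥0} (hσ : 0 < σ) (C z : ℝ) : 0 < alphaHat σ C z :=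
  div_pos (noisePDF_pos hσ _) (noiseVariance_pos hσ _)

lemma betaHat_eq (σ : ℝ≥0) (C z : ℝ) :
    betaHat σ C z = alphaHat σ C z * noisePDF σ (C - z) := by
  unfold betaHat alphaHat
  ring

lemma continuous_betaHat {σ : ℝ≥0} (hσ : 0 < σ) (C : ℝ) : Continuous (betaHat σ C) := by
  have h2 := (contDiff_noisePDF σ).continuous
  have h3 := continuous_alphaHat hσ C
  simp_rw [funext (betaHat_eq σ C)]
  fun_prop

lemma betaHat_pos {σ : ℝ≥0} (hσ : 0 < σ) (C z : ℝ) : 0 < betaHat σ C z := by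
  rw [betaHat_eq]
  exact mul_pos (alphaHat_pos hσ C z) (noisePDF_pos hσ _)

lemma exists_bounds_on_Icc {g : ℝ → ℝ} (hg : Continuous g) (hpos : ∀ x, 0 < g x) (a b : ℝ) :
    ∃ l L : ℝ, 0 < l ∧ 0 < L ∧ ∀ x ∈ Set.Icc a b, l ≤ g x ∧ g x ≤ L := by
  rcases (Set.Icc a b).eq_empty_or_nonempty with h | h
  -- Admitting an empty interval allows use on `[-M, M]` before the sign of `M` is known.
  · exact ⟨1, 1, one_pos, one_pos, by simp [h]⟩
  · obtain ⟨x, -, hx⟩ := isCompact_Icc.exists_isMinOn h hg.continuousOn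
    obtain ⟨y, -, hy⟩ := isCompact_Icc.exists_isMaxOn h hg.continuousOn
    exact ⟨g x, g y, hpos x, hpos y, fun t ht => ⟨hx ht, hy ht⟩⟩

lemma mul_sub_le_noiseCDF_sub {σ : ℝ≥0} (hσ : 0 < σ) {a b l : ℝ}
    (hl : ∀ x ∈ Set.Icc a b, l ≤ noisePDF σ x) {x y : ℝ} (hx : a ≤ x) (hxy : x ≤ y)
    (hy : y ≤ b) : l * (y - x) ≤ noiseCDF σ y - noiseCDF σ x := by
  refine (convex_Icc a b).mul_sub_le_image_sub_of_le_deriv (continuous_noiseCDF hσ).continuousOn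
    (fun z _ => (hasDerivAt_noiseCDF hσ z).differentiableAt.differentiableWithinAt)
    (fun z hz => ?_) x ⟨hx, hxy.trans hy⟩ y ⟨hx.trans hxy, hy⟩ hxy
  rw [(hasDerivAt_noiseCDF hσ z).deriv]
  exact hl z (interior_subset hz)

/-- Mean value inequality for `F(t) - f(x) t`, whose derivative `f(t) - f(x)` is controlled by a
Lipschitz constant of `f` on the compact interval. -/
lemma exists_noiseCDF_taylor_bound {σ : ℝ≥0} (hσ : 0 < σ) (a b : ℝ) :
    ∃ L : ℝ, 0 ≤ L ∧ ∀ x ∈ Set.Icc a b, ∀ y ∈ Set.Icc a b,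
      |noiseCDF σ y - noiseCDF σ x - noisePDF σ x * (y - x)| ≤ L * (y - x) ^ 2 := by
  obtain ⟨L, hL⟩ := (contDiff_noisePDF σ).locallyLipschitz.locallyLipschitzOn
    |>.exists_lipschitzOnWith_of_compact (isCompact_Icc (a := a) (b := b))
  refine ⟨L, L.2, fun x hx y hy => ?_⟩
  have hsub : Set.uIcc x y ⊆ Set.Icc a b := Set.uIcc_subset_Icc hx hy
  have key := (convex_uIcc x y).norm_image_sub_le_of_norm_hasDerivWithin_le
    (f := fun t => noiseCDF σ t - noisePDF σ x * t)
    (f' := fun t => noisePDF σ t - noisePDF σ x) (C := L * |y - x|)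
    (fun t _ => by
      have h1 := (hasDerivAt_noiseCDF hσ t).sub ((hasDerivAt_id t).const_mul (noisePDF σ x))
      rw [mul_one] at h1
      exact h1.hasDerivWithinAt)
    (fun t ht => by
      have h1 := hL.dist_le_mul t (hsub ht) x hx
      rw [Real.dist_eq, Real.dist_eq] at h1
      refine h1.trans (mul_le_mul_of_nonneg_left ?_ L.2)
      exact Set.abs_sub_left_of_mem_uIcc ht)
    Set.left_mem_uIcc Set.right_mem_uIcc
  rw [Real.norm_eq_abs, Real.norm_eq_abs, mul_assoc, ← sq, sq_abs] at key
  convert key using 2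
  ring

/-! ### Cut-off, acceleration and the mean innovation -/

lemma abs_cutoff_le {M : ℝ} (hM : 0 ≤ M) (x : ℝ) : |cutoff M x| ≤ M := by
  unfold cutoff
  split_ifs with h1 h2
  · exact (abs_of_nonneg hM).le
  · rw [abs_neg, abs_of_nonneg hM]
  · exact abs_le.2 ⟨not_lt.1 h2, not_lt.1 h1⟩

lemma cutoff_of_abs_le {M x : ℝ} (hx : |x| ≤ M) : cutoff M x = x := by
  unfold cutoff
  rw [if_neg (not_lt.2 (abs_le.1 hx).2), if_neg (not_lt.2 (abs_le.1 hx).1)]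

lemma accel_of_abs_le {M x : ℝ} (hx : |x| ≤ M) : accel M x = 1 := if_pos hx

lemma accel_nonneg (M x : ℝ) : 0 ≤ accel M x := by
  unfold accel
  split_ifs <;> positivity

lemma accel_le (M x : ℝ) : accel M x ≤ 1 + |x| := by
  unfold accel
  split_ifs
  · linarith [abs_nonneg x]
  · linarith

/-- The mean of the innovation term, as a function of `t = φ_k θ̂_{k-1}` and `y = φ_k θ`. -/
def meanInnovation (σ : ℝ≥0) (C M t y : ℝ) : ℝ :=
  accel M t * alphaHat σ C (cutoff M t) *
    (noiseCDF σ (C - cutoff M t) - noiseCDF σ (C - y))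

/-- Inside the cut-off this is strict monotonicity of `F` on a compact interval. Outside, the gap 2
between `|y|` and `M` keeps the difference of the distribution functions at least `2 * l`, while `γ
= |t|` restores linear growth because `|t - y| ≤ 2 * |t|`. -/
lemma exists_meanInnovation_mul_le {σ : ℝ≥0} (hσ : 0 < σ) (C : ℝ) {M : ℝ} :
    ∃ c : ℝ, 0 < c ∧ ∀ t y : ℝ, |y| ≤ M - 2 →
      meanInnovation σ C M t y * (t - y) ≤ -c * (t - y) ^ 2 := by
  obtain ⟨l, _, hl, _, hlb⟩ := exists_bounds_on_Icc (contDiff_noisePDF σ).continuous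
    (noisePDF_pos hσ) (C - M) (C + M)
  obtain ⟨α, _, hα, _, hαb⟩ := exists_bounds_on_Icc (continuous_alphaHat hσ C)
    (alphaHat_pos hσ C) (-M) M
  refine ⟨α * l, mul_pos hα hl, fun t y hy => ?_⟩
  have hM : 0 ≤ M := by linarith [abs_nonneg y]
  obtain ⟨hy1, hy2⟩ := abs_le.1 hy
  have hz := abs_le.1 (abs_cutoff_le hM t)
  have hαz := (hαb _ hz).1
  have mono : ∀ p q : ℝ, -M ≤ p → p ≤ q → q ≤ M →
      l * (q - p) ≤ noiseCDF σ (C - p) - noiseCDF σ (C - q) := fun p q hp hpq hq => by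
    have := mul_sub_le_noiseCDF_sub hσ (fun x hx => (hlb x hx).1)
      (x := C - q) (y := C - p) (by linarith) (by linarith) (by linarith)
    linarith
  unfold meanInnovation
  suffices h : l * (t - y) ^ 2 ≤ accel M t *
      (noiseCDF σ (C - y) - noiseCDF σ (C - cutoff M t)) * (t - y) by
    have h0 : 0 ≤ l * (t - y) ^ 2 := by positivity
    nlinarith [mul_le_mul hαz h h0 (hα.le.trans hαz)]
  by_cases ht : |t| ≤ M
  · rw [cutoff_of_abs_le ht, accel_of_abs_le ht, one_mul]
    obtain ⟨ht1, ht2⟩ := abs_le.1 ht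
    rcases le_total y t with h | h
    · nlinarith [mul_le_mul_of_nonneg_right (mono y t (by linarith) h ht2) (sub_nonneg.2 h)]
    · nlinarith [mul_le_mul_of_nonneg_right (mono t y ht1 h (by linarith)) (sub_nonneg.2 h)]
  · have hac : accel M t = |t| := if_neg ht
    rw [hac]
    rcases lt_abs.1 (not_le.1 ht) with h | h
    · have hc : cutoff M t = M := if_pos h
      have hm := mono y M (by linarith) (by linarith) le_rfl
      rw [hc, abs_of_pos (by linarith)]
      have h2 : l * 2 ≤ noiseCDF σ (C - y) - noiseCDF σ (C - M) :=
        (mul_le_mul_of_nonneg_left (by linarith) hl.le).trans hm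
      have h3 : 0 ≤ t * (t - y) := mul_nonneg (by linarith) (by linarith)
      have h4 : (t - y) * (t - y) ≤ 2 * t * (t - y) :=
        mul_le_mul_of_nonneg_right (by linarith) (by linarith)
      nlinarith [mul_le_mul_of_nonneg_right h2 h3, mul_le_mul_of_nonneg_left h4 hl.le]
    · have hc : cutoff M t = -M := by
        unfold cutoff
        rw [if_neg (by linarith), if_pos (by linarith)]
      have hm := mono (-M) y le_rfl (by linarith) (by linarith)
      rw [hc, abs_of_neg (by linarith)]
      have h2 : l * 2 ≤ noiseCDF σ (C - -M) - noiseCDF σ (C - y) :=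
        (mul_le_mul_of_nonneg_left (by linarith) hl.le).trans hm
      have h3 : 0 ≤ (-t) * (y - t) := mul_nonneg (by linarith) (by linarith)
      have h4 : (y - t) * (y - t) ≤ 2 * (-t) * (y - t) :=
        mul_le_mul_of_nonneg_right (by linarith) (by linarith)
      nlinarith [mul_le_mul_of_nonneg_right h2 h3, mul_le_mul_of_nonneg_left h4 hl.le]

lemma abs_noiseCDF_sub_le_one (σ : ℝ≥0) (x y : ℝ) : |noiseCDF σ x - noiseCDF σ y| ≤ 1 := by
  have h1 : 0 ≤ noiseCDF σ x := cdf_nonneg _ x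
  have h2 : noiseCDF σ x ≤ 1 := cdf_le_one _ x
  have h3 : 0 ≤ noiseCDF σ y := cdf_nonneg _ y
  have h4 : noiseCDF σ y ≤ 1 := cdf_le_one _ y
  exact abs_le.2 ⟨by linarith, by linarith⟩

/-- `β̂ = α̂ f̂` is the slope that cancels the first-order part of the innovation, so Taylor's
formula applies inside the cut-off. Outside, `|t - y| ≥ 2`, and terms of linear growth are dominated
by the square. -/
lemma exists_linearization_bound {σ : ℝ≥0} (hσ : 0 < σ) (C : ℝ) {M : ℝ} :
    ∃ L : ℝ, 0 ≤ L ∧ ∀ t y : ℝ, |y| ≤ M - 2 →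
      |betaHat σ C (cutoff M t) * (t - y) + meanInnovation σ C M t y| ≤ L * (t - y) ^ 2 := by
  obtain ⟨_, α, _, hα, hαb⟩ := exists_bounds_on_Icc (continuous_alphaHat hσ C)
    (alphaHat_pos hσ C) (-M) M
  obtain ⟨_, β, _, hβ, hβb⟩ := exists_bounds_on_Icc (continuous_betaHat hσ C)
    (betaHat_pos hσ C) (-M) M
  obtain ⟨T, hT, hTb⟩ := exists_noiseCDF_taylor_bound hσ (C - M) (C + M)
  -- The first summand serves the Taylor case, the other two the region `|t| > M`.
  refine ⟨α * T + β + α * (1 + |M|), by positivity, fun t y hy => ?_⟩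
  have hM : 0 ≤ M := by linarith [abs_nonneg y]
  obtain ⟨hy1, hy2⟩ := abs_le.1 hy
  have hz := abs_le.1 (abs_cutoff_le hM t)
  have hαz := (hαb _ hz).2
  have hα0 := (alphaHat_pos hσ C (cutoff M t)).le
  rw [abs_of_nonneg hM]
  unfold meanInnovation
  have hsq := sq_nonneg (t - y)
  by_cases ht : |t| ≤ M
  · rw [betaHat_eq, accel_of_abs_le ht]
    rw [cutoff_of_abs_le ht] at *
    obtain ⟨ht1, ht2⟩ := abs_le.1 ht
    have h1 := hTb (C - t) ⟨by linarith, by linarith⟩ (C - y) ⟨by linarith, by linarith⟩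
    have h2 : alphaHat σ C t * noisePDF σ (C - t) * (t - y) +
        1 * alphaHat σ C t * (noiseCDF σ (C - t) - noiseCDF σ (C - y)) =
        -(alphaHat σ C t * (noiseCDF σ (C - y) - noiseCDF σ (C - t) -
          noisePDF σ (C - t) * (C - y - (C - t)))) := by ring
    rw [h2, abs_neg, abs_mul, abs_of_nonneg hα0]
    calc _ ≤ α * (T * (C - y - (C - t)) ^ 2) := mul_le_mul hαz h1 (abs_nonneg _) hα.le
      _ = α * T * (t - y) ^ 2 := by ring
      _ ≤ _ := mul_le_mul_of_nonneg_right (by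
        have : 0 ≤ α * (1 + M) := by positivity
        linarith) hsq
  · have hac : accel M t = |t| := if_neg ht
    rw [hac]
    have htM := not_le.1 ht
    have h1 : |t| ≤ |t - y| + |y| := by simpa using abs_add_le (t - y) y
    have h2 : 2 ≤ |t - y| := by linarith
    have h3 : |t - y| ≤ (t - y) ^ 2 := by
      rw [← sq_abs]
      nlinarith
    have h4 : 1 ≤ (t - y) ^ 2 := by linarith
    have hβz := (hβb _ hz).2
    have hβ0 := (betaHat_pos hσ C (cutoff M t)).le
    refine (abs_add_le _ _).trans ?_
    rw [abs_mul, abs_mul, abs_mul, abs_abs, abs_of_nonneg hα0, abs_of_nonneg hβ0]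
    have h5 : betaHat σ C (cutoff M t) * |t - y| ≤ β * (t - y) ^ 2 :=
      mul_le_mul hβz h3 (abs_nonneg _) hβ.le
    have h6 : |t| ≤ (1 + M) * (t - y) ^ 2 := by nlinarith
    have h7 : |t| * alphaHat σ C (cutoff M t) ≤ (1 + M) * (t - y) ^ 2 * α :=
      mul_le_mul h6 hαz hα0 (by positivity)
    have h8 := mul_le_mul h7 (abs_noiseCDF_sub_le_one σ (C - cutoff M t) (C - y))
      (abs_nonneg _) (by positivity)
    have h9 : 0 ≤ α * T * (t - y) ^ 2 := by positivity
    linarith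

end IMPF

/-! ### Scalar recursions and elementary power inequalities -/

/-- A recursive inequality with contraction rate `3 v² / A` and forcing `v² / A²` has solutions
of order `1 / A`. -/
lemma exists_mul_le_of_contraction {w A v : ℕ → ℝ} {U C : ℝ} (hw : ∀ k, 0 ≤ w k)
    (hA1 : ∀ k, 1 ≤ A k) (hA : ∀ k, A (k + 1) = A k + v k ^ 2) (hAt : Tendsto A atTop atTop)
    (hv : ∀ k, v k ^ 2 ≤ U) (hC : 0 ≤ C)
    (h : ∀ k, w (k + 1) ≤ (1 - 3 * v k ^ 2 / A (k + 1) + C * v k ^ 2 / A (k + 1) ^ 2) * w k +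
      C * v k ^ 2 / A (k + 1) ^ 2) :
    ∃ K : ℝ, 0 ≤ K ∧ ∀ k, A k * w k ≤ K := by
  obtain ⟨k₀, hk₀⟩ := eventually_atTop.1 (hAt.eventually_ge_atTop (max C U))
  have hAw : ∀ k, 0 ≤ A k * w k := fun k => mul_nonneg (by linarith [hA1 k]) (hw k)
  have hS : 0 ≤ ∑ i ∈ Finset.range (k₀ + 1), A i * w i := Finset.sum_nonneg fun i _ => hAw i
  -- The sum dominates each term up to `k₀`; adding `C` absorbs the forcing afterwards.
  refine ⟨(∑ i ∈ Finset.range (k₀ + 1), A i * w i) + C, by positivity, fun k => ?_⟩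
  set K := (∑ i ∈ Finset.range (k₀ + 1), A i * w i) + C with hK
  have hsmall : ∀ k ≤ k₀, A k * w k ≤ K := fun k hk => by
    have := Finset.single_le_sum (f := fun i => A i * w i) (fun i _ => hAw i)
      (Finset.mem_range_succ_iff.2 hk)
    linarith
  induction k with
  | zero => exact hsmall 0 (Nat.zero_le _)
  | succ k ih =>
    rcases Nat.lt_or_ge k k₀ with hk | hk
    · exact hsmall (k + 1) hk
    have hk' := hk₀ k hk
    have hCA : C ≤ A k := (le_max_left _ _).trans hk'
    have hvA : v k ^ 2 ≤ A k := (hv k).trans ((le_max_right _ _).trans hk')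
    have hA0 : 0 < A k := by linarith [hA1 k]
    have hA0' : 0 < A (k + 1) := by linarith [hA1 (k + 1)]
    have hv0 := sq_nonneg (v k)
    have hle : A k ≤ A (k + 1) := by linarith [hA k]
    have hCA' : C * v k ^ 2 / A (k + 1) ≤ v k ^ 2 := by
      rw [div_le_iff₀ hA0']
      nlinarith
    have hCA2 : C * v k ^ 2 / A (k + 1) ≤ C * v k ^ 2 / A k :=
      div_le_div_of_nonneg_left (by positivity) hA0 hle
    calc A (k + 1) * w (k + 1)
        ≤ A (k + 1) * ((1 - 3 * v k ^ 2 / A (k + 1) + C * v k ^ 2 / A (k + 1) ^ 2) * w k +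
          C * v k ^ 2 / A (k + 1) ^ 2) := mul_le_mul_of_nonneg_left (h k) hA0'.le
      _ = (A (k + 1) - 3 * v k ^ 2 + C * v k ^ 2 / A (k + 1)) * w k +
          C * v k ^ 2 / A (k + 1) := by field_simp
      -- Of the three units of `v k ^ 2`, one pays for the growth of `A`, one for the `C`
      -- correction, and one survives as contraction.
      _ ≤ (A k - v k ^ 2) * w k + C * v k ^ 2 / A k :=
          add_le_add (mul_le_mul_of_nonneg_right (by linarith [hA k]) (hw k)) hCA2
      _ = (1 - v k ^ 2 / A k) * (A k * w k) + C * v k ^ 2 / A k := by field_simp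
      _ ≤ (1 - v k ^ 2 / A k) * K + K * v k ^ 2 / A k := by
          refine add_le_add (mul_le_mul_of_nonneg_left ih ?_) ?_
          · rw [sub_nonneg, div_le_one hA0]
            exact hvA
          · gcongr
            linarith
      _ = K := by ring

/-- The homogeneous growth rate is half that of `A`, so `K * A` is a supersolution once `K ≥ 2 * C`.
-/
lemma exists_le_mul_of_growth {u A v : ℕ → ℝ} {C : ℝ} (hA1 : ∀ k, 1 ≤ A k)
    (hA : ∀ k, A (k + 1) = A k + v k ^ 2) (hu : 0 ≤ u 0) (hC : 0 ≤ C)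
    (h : ∀ k, u (k + 1) ≤ (1 + v k ^ 2 / (2 * A k)) * u k + C * v k ^ 2) :
    ∃ K : ℝ, 0 ≤ K ∧ ∀ k, u k ≤ K * A k := by
  refine ⟨u 0 + 2 * C, by positivity, fun k => ?_⟩
  induction k with
  | zero => nlinarith [hA1 0]
  | succ k ih =>
    have hA0 : 0 < A k := by linarith [hA1 k]
    calc u (k + 1) ≤ (1 + v k ^ 2 / (2 * A k)) * u k + C * v k ^ 2 := h k
      _ ≤ (1 + v k ^ 2 / (2 * A k)) * ((u 0 + 2 * C) * A k) + C * v k ^ 2 := by gcongr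
      _ = (u 0 + 2 * C) * (A k + v k ^ 2 / 2) + C * v k ^ 2 := by field_simp
      _ ≤ (u 0 + 2 * C) * A (k + 1) := by
        rw [hA]
        nlinarith [mul_nonneg hu (sq_nonneg (v k))]

/-- First order Taylor bound for a power, under a relative bound on the increment. -/
lemma exists_pow_taylor_bound {T : ℝ} (hT : 0 ≤ T) (p : ℕ) :
    ∃ K : ℝ, 0 ≤ K ∧ ∀ x h R τ : ℝ, |x| ≤ R → 0 ≤ τ → τ ≤ T → |h| ≤ τ * R →
      |(x + h) ^ (p + 1) - x ^ (p + 1) - (p + 1) * (x ^ p * h)| ≤ K * (τ ^ 2 * R ^ (p + 1)) := by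
  induction p with
  | zero => exact ⟨0, le_rfl, fun x h R τ _ _ _ _ => by simp⟩
  | succ p ih =>
    obtain ⟨K, hK, hb⟩ := ih
    refine ⟨(1 + T) * K + (p + 1), by positivity, fun x h R τ hx hτ hτT hh => ?_⟩
    have hR : 0 ≤ R := (abs_nonneg x).trans hx
    have heq : (x + h) ^ (p + 1 + 1) - x ^ (p + 1 + 1) - ((p + 1 : ℕ) + 1) * (x ^ (p + 1) * h) =
        (x + h) * ((x + h) ^ (p + 1) - x ^ (p + 1) - (p + 1) * (x ^ p * h)) +
        (p + 1) * (x ^ p * h ^ 2) := by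
      push_cast
      ring
    rw [heq]
    refine (abs_add_le _ _).trans ?_
    rw [abs_mul, abs_mul, abs_mul, abs_pow, abs_pow, abs_of_nonneg (by positivity : (0 : ℝ) ≤ p + 1)]
    have h1 : |x + h| ≤ (1 + T) * R := by
      have := abs_add_le x h
      have := mul_le_mul_of_nonneg_right hτT hR
      linarith
    have h2 := mul_le_mul h1 (hb x h R τ hx hτ hτT hh) (abs_nonneg _) (by positivity)
    have h3 : |x| ^ p * |h| ^ 2 ≤ R ^ p * (τ * R) ^ 2 := by gcongr
    have h4 := mul_le_mul_of_nonneg_left h3 (by positivity : (0 : ℝ) ≤ p + 1)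
    refine (add_le_add h2 h4).trans (le_of_eq ?_)
    ring

/-- Interpolates the cubic cross term between a second moment with small coefficient and a high
moment. -/
lemma abs_cube_le {ε : ℝ} (hε : 0 < ε) {p : ℕ} (hp : 3 ≤ p) (x : ℝ) :
    |x| ^ 3 ≤ ε * x ^ 2 + |x| ^ p / ε ^ (p - 3) := by
  have hx := abs_nonneg x
  rcases le_total |x| ε with h | h
  · have : |x| ^ 3 ≤ ε * x ^ 2 := by
      rw [← sq_abs x, pow_succ, mul_comm]
      gcongr
    have : 0 ≤ |x| ^ p / ε ^ (p - 3) := by positivity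
    linarith
  · have h1 : |x| ^ 3 ≤ |x| ^ p / ε ^ (p - 3) := by
      rw [le_div_iff₀ (by positivity)]
      calc |x| ^ 3 * ε ^ (p - 3) ≤ |x| ^ 3 * |x| ^ (p - 3) := by gcongr
        _ = |x| ^ p := by rw [← pow_add, Nat.add_sub_cancel' hp]
    have : 0 ≤ ε * x ^ 2 := by positivity
    linarith

lemma pow_le_one_add_pow {x : ℝ} (hx : 0 ≤ x) {m p : ℕ} (h : m ≤ p) : x ^ m ≤ 1 + x ^ p := by
  rcases le_total x 1 with h1 | h1
  · linarith [pow_le_one₀ (n := m) hx h1, pow_nonneg hx p]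
  · linarith [pow_le_pow_right₀ h1 h]

/-! ### Abstract recursive estimator with martingale-difference noise -/

/-- Bounded functions that are measurable with respect to a given `σ`-algebra. -/
def BddMeasurable {Ω : Type*} (m : MeasurableSpace Ω) (f : Ω → ℝ) : Prop :=
  Measurable[m] f ∧ ∃ B : ℝ, ∀ ω, |f ω| ≤ B

namespace BddMeasurable

variable {Ω : Type*} {m : MeasurableSpace Ω} {f g : Ω → ℝ}

lemma const (c : ℝ) : BddMeasurable m fun _ => c := ⟨measurable_const, |c|, fun _ => le_rfl⟩

lemma add (hf : BddMeasurable m f) (hg : BddMeasurable m g) :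
    BddMeasurable m fun ω => f ω + g ω := by
  obtain ⟨hf, F, hF⟩ := hf
  obtain ⟨hg, G, hG⟩ := hg
  exact ⟨hf.add hg, F + G, fun ω => (abs_add_le _ _).trans (add_le_add (hF ω) (hG ω))⟩

lemma mul (hf : BddMeasurable m f) (hg : BddMeasurable m g) :
    BddMeasurable m fun ω => f ω * g ω := by
  obtain ⟨hf, F, hF⟩ := hf
  obtain ⟨hg, G, hG⟩ := hg
  refine ⟨hf.mul hg, F * G, fun ω => ?_⟩
  rw [abs_mul]
  exact mul_le_mul (hF ω) (hG ω) (abs_nonneg _) ((abs_nonneg _).trans (hF ω))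

lemma pow (hf : BddMeasurable m f) (n : ℕ) : BddMeasurable m fun ω => f ω ^ n := by
  obtain ⟨hf, F, hF⟩ := hf
  refine ⟨hf.pow_const n, F ^ n, fun ω => ?_⟩
  rw [abs_pow]
  exact pow_le_pow_left₀ (abs_nonneg _) (hF ω) n

lemma inv (hf : BddMeasurable m f) {q : ℝ} (hq : 0 < q) (h : ∀ ω, q ≤ f ω) :
    BddMeasurable m fun ω => (f ω)⁻¹ :=
  ⟨hf.1.inv, q⁻¹, fun ω => by
    rw [abs_of_pos (inv_pos.2 (hq.trans_le (h ω)))]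
    exact inv_anti₀ hq (h ω)⟩

lemma mono {m' : MeasurableSpace Ω} (hf : BddMeasurable m f) (h : m ≤ m') :
    BddMeasurable m' f := ⟨hf.1.mono h le_rfl, hf.2⟩

lemma integrable (hf : BddMeasurable m f) (μ : Measure Ω) [IsFiniteMeasure μ] :
    Integrable f μ := by
  obtain ⟨hf, F, hF⟩ := hf
  exact Integrable.of_bound hf.aestronglyMeasurable F (Eventually.of_forall hF)

end BddMeasurable

/-- A scalar recursive estimator driven by martingale-difference noise `Z` and by the input `v`:
`X` is the estimation error, `Q` the reciprocal of the gain, `m` the drift and `a` the noise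
amplitude. -/
structure RecursiveError {Ω : Type*} [mΩ : MeasurableSpace Ω] (μ : Measure Ω)
    (ℱ : ℕ → MeasurableSpace Ω) (v : ℕ → ℝ) (X Q β m a Z : ℕ → Ω → ℝ)
    (q b B c K V : ℝ) : Prop where
  q_pos : 0 < q
  b_pos : 0 < b
  c_pos : 0 < c
  K_pos : 0 < K
  sigma_le : ∀ k, ℱ k ≤ mΩ
  bdd_X : ∀ k, BddMeasurable (ℱ k) (X k)
  bdd_Q : ∀ k, BddMeasurable (ℱ k) (Q k)
  bdd_β : ∀ k, BddMeasurable (ℱ k) (β k)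
  bdd_m : ∀ k, BddMeasurable (ℱ k) (m k)
  bdd_a : ∀ k, BddMeasurable (ℱ k) (a k)
  bdd_Z : ∀ k, BddMeasurable mΩ (Z k)
  integral_mul_Z : ∀ k Y, BddMeasurable (ℱ k) Y → ∫ ω, Y ω * Z k ω ∂μ = 0
  abs_Z_le : ∀ k ω, |Z k ω| ≤ 1
  Q_zero : ∀ ω, Q 0 ω = q
  Q_succ : ∀ k ω, Q (k + 1) ω = Q k ω + β k ω * v k ^ 2
  le_β : ∀ k ω, b ≤ β k ω
  β_le : ∀ k ω, β k ω ≤ B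
  X_succ : ∀ k ω, X (k + 1) ω = X k ω + v k / Q (k + 1) ω * (m k ω + a k ω * Z k ω)
  abs_a_le : ∀ k ω, |a k ω| ≤ K * (1 + |X k ω|)
  abs_m_le : ∀ k ω, |m k ω| ≤ K * (1 + |X k ω|)
  drift : ∀ k ω, v k * m k ω * X k ω ≤ -c * (v k ^ 2 * X k ω ^ 2)
  linearization : ∀ k ω, |β k ω * v k ^ 2 * X k ω + v k * m k ω| ≤ K * (v k ^ 2 * X k ω ^ 2)
  abs_v_le : ∀ k, |v k| ≤ V

/-- The accumulated energy `1 + ∑_{i < k} v_i²` of the input. -/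
def energy (v : ℕ → ℝ) (k : ℕ) : ℝ := 1 + ∑ i ∈ Finset.range k, v i ^ 2

lemma energy_succ (v : ℕ → ℝ) (k : ℕ) : energy v (k + 1) = energy v k + v k ^ 2 := by
  unfold energy
  rw [Finset.sum_range_succ]
  ring

lemma one_le_energy (v : ℕ → ℝ) (k : ℕ) : 1 ≤ energy v k :=
  le_add_of_nonneg_right (Finset.sum_nonneg fun i _ => sq_nonneg (v i))

lemma integral_le_of_forall_le {Ω : Type*} [MeasurableSpace Ω] {μ : Measure Ω}
    [IsProbabilityMeasure μ] {f' f N : Ω → ℝ} {α γ : ℝ} (hf' : Integrable f' μ)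
    (hf : Integrable f μ) (hN : Integrable N μ) (hN0 : ∫ ω, N ω ∂μ = 0)
    (h : ∀ ω, f' ω ≤ α * f ω + γ + N ω) : ∫ ω, f' ω ∂μ ≤ α * ∫ ω, f ω ∂μ + γ := by
  have h1 : Integrable (fun ω => α * f ω + γ) μ := (hf.const_mul α).add (integrable_const γ)
  calc ∫ ω, f' ω ∂μ ≤ ∫ ω, (α * f ω + γ + N ω) ∂μ := integral_mono hf' (h1.add hN) h
    _ = α * ∫ ω, f ω ∂μ + γ := by
      rw [integral_add h1 hN, integral_add (hf.const_mul α) (integrable_const γ),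
        integral_const_mul, hN0]
      simp

/-! ### Moment estimates for the recursive estimator -/

namespace RecursiveError

variable {Ω : Type*} [mΩ : MeasurableSpace Ω] {μ : Measure Ω}
  {ℱ : ℕ → MeasurableSpace Ω} {v : ℕ → ℝ} {X Q β m a Z : ℕ → Ω → ℝ} {q b B c K V : ℝ}

/-- With its upper companion, this replaces the random gain by deterministic coefficients in the
moment recursions. -/
lemma min_mul_energy_le (H : RecursiveError μ ℱ v X Q β m a Z q b B c K V) (k : ℕ) (ω : Ω) :
    min q b * energy v k ≤ Q k ω := by
  induction k with
  | zero => simp [energy, H.Q_zero ω]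
  | succ k ih =>
    rw [energy_succ, H.Q_succ, mul_add]
    exact add_le_add ih (mul_le_mul_of_nonneg_right ((min_le_right _ _).trans (H.le_β k ω))
      (sq_nonneg _))

lemma le_max_mul_energy (H : RecursiveError μ ℱ v X Q β m a Z q b B c K V) (k : ℕ) (ω : Ω) :
    Q k ω ≤ max q B * energy v k := by
  induction k with
  | zero => simp [energy, H.Q_zero ω]
  | succ k ih =>
    rw [energy_succ, H.Q_succ, mul_add]
    exact add_le_add ih (mul_le_mul_of_nonneg_right ((H.β_le k ω).trans (le_max_right _ _))
      (sq_nonneg _))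

lemma min_pos (H : RecursiveError μ ℱ v X Q β m a Z q b B c K V) : 0 < min q b :=
  lt_min H.q_pos H.b_pos

lemma min_le_Q (H : RecursiveError μ ℱ v X Q β m a Z q b B c K V) (k : ℕ) (ω : Ω) :
    min q b ≤ Q k ω :=
  (le_mul_of_one_le_right H.min_pos.le (one_le_energy v k)).trans (H.min_mul_energy_le k ω)

lemma Q_pos (H : RecursiveError μ ℱ v X Q β m a Z q b B c K V) (k : ℕ) (ω : Ω) : 0 < Q k ω :=
  H.min_pos.trans_le (H.min_le_Q k ω)

/-- The gain is predictable, so it may multiply `Z k` without destroying the zero mean. -/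
lemma bdd_Q_succ (H : RecursiveError μ ℱ v X Q β m a Z q b B c K V) (k : ℕ) :
    BddMeasurable (ℱ k) (Q (k + 1)) := by
  rw [funext (H.Q_succ k)]
  exact (H.bdd_Q k).add ((H.bdd_β k).mul (.const _))

/-- First-order Taylor expansion of the power: the drift contracts at rate `(2 * n + 2) * c / Q (k +
1)`, at least `3 / A` by `hn`, and the remainder is quadratic in a step of relative size `v / A`. -/
lemma exists_pow_step_bound (H : RecursiveError μ ℱ v X Q β m a Z q b B c K V) {n : ℕ}
    (hn : 3 * max q B ≤ (2 * n + 2) * c) :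
    ∃ C : ℝ, 0 ≤ C ∧ ∀ k ω, X (k + 1) ω ^ (2 * n + 2) ≤
      (1 - 3 * v k ^ 2 / energy v (k + 1) + C * v k ^ 2 / energy v (k + 1) ^ 2) *
        X k ω ^ (2 * n + 2) + C * v k ^ 2 / energy v (k + 1) ^ 2 +
      (2 * n + 2) * X k ω ^ (2 * n + 1) * v k * (Q (k + 1) ω)⁻¹ * a k ω * Z k ω := by
  have hc0 := H.min_pos
  have hK := H.K_pos
  have hV : 0 ≤ V := (abs_nonneg _).trans (H.abs_v_le 0)
  obtain ⟨L, hL, hLb⟩ := exists_pow_taylor_bound (T := 2 * K * V / min q b) (by positivity)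
    (2 * n + 1)
  refine ⟨L * (2 * K / min q b) ^ 2 * 2 ^ (2 * n + 1), by positivity, fun k ω => ?_⟩
  set A := energy v (k + 1) with hA
  have hA1 : 1 ≤ A := one_le_energy v (k + 1)
  have hA0 : 0 < A := by linarith
  have hq0 := H.Q_pos (k + 1) ω
  have hqA := H.le_max_mul_energy (k + 1) ω
  have hAq := H.min_mul_energy_le (k + 1) ω
  have hX1 := H.X_succ k ω
  have ha := H.abs_a_le k ω
  have hm := H.abs_m_le k ω
  have hZ := H.abs_Z_le k ω
  have hd := H.drift k ω
  have hv := H.abs_v_le k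
  rw [← hA] at hqA hAq
  rw [hX1]
  generalize X k ω = x at *
  generalize Q (k + 1) ω = r at *
  generalize a k ω = a at *
  generalize m k ω = m at *
  generalize Z k ω = z at *
  generalize v k = v at *
  have hnoise : |m + a * z| ≤ 2 * K * (1 + |x|) := by
    have h1 : |a * z| ≤ K * (1 + |x|) * 1 := by
      rw [abs_mul]
      exact mul_le_mul ha hZ (abs_nonneg _) (by positivity)
    linarith [abs_add_le m (a * z)]
  -- Size of the increment relative to `1 + |x|`.
  set τ := 2 * K * |v| / (min q b * A) with hτ
  have hτT : τ ≤ 2 * K * V / min q b := by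
    rw [hτ]
    gcongr
    exact le_mul_of_one_le_right hc0.le hA1
  have hh : |v / r * (m + a * z)| ≤ τ * (1 + |x|) := by
    rw [abs_mul, abs_div, abs_of_pos hq0]
    calc |v| / r * |m + a * z| ≤ |v| / (min q b * A) * (2 * K * (1 + |x|)) := by gcongr
      _ = τ * (1 + |x|) := by
        rw [hτ]
        ring
  have key := (abs_le.1 (hLb x _ (1 + |x|) τ (by linarith) (by positivity) hτT hh)).2
  have hτ2 : τ ^ 2 = (2 * K / min q b) ^ 2 * (v ^ 2 / A ^ 2) := by
    rw [hτ, ← sq_abs v]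
    field_simp
  have hpow : (1 + |x|) ^ (2 * n + 1 + 1) ≤ 2 ^ (2 * n + 1) * (1 + x ^ (2 * n + 2)) := by
    have := add_pow_le (zero_le_one' ℝ) (abs_nonneg x) (2 * n + 2)
    rw [one_pow, Even.pow_abs ⟨n + 1, by ring⟩] at this
    exact this
  have hx2n : (0 : ℝ) ≤ x ^ (2 * n) := Even.pow_nonneg ⟨n, by ring⟩ x
  have hdrift : (2 * n + 2) * (x ^ (2 * n + 1) * (v / r * m)) ≤
      -(3 * v ^ 2 / A * x ^ (2 * n + 2)) := by
    have h1 : (2 * n + 2) * (x ^ (2 * n + 1) * (v / r * m)) =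
        (2 * n + 2) * x ^ (2 * n) / r * (v * m * x) := by
      field_simp
      ring
    rw [h1]
    have h2 : (2 * n + 2) * x ^ (2 * n) / r * (v * m * x) ≤
        (2 * n + 2) * x ^ (2 * n) / r * (-c * (v ^ 2 * x ^ 2)) :=
      mul_le_mul_of_nonneg_left hd (by positivity)
    refine h2.trans ?_
    have h3 : 3 / A ≤ (2 * n + 2) * c / r := by
      rw [div_le_div_iff₀ hA0 hq0]
      nlinarith
    have h4 := mul_le_mul_of_nonneg_right h3 (by positivity : 0 ≤ v ^ 2 * x ^ 2 * x ^ (2 * n))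
    refine le_of_eq_of_le (b := -((2 * n + 2) * c / r * (v ^ 2 * x ^ 2 * x ^ (2 * n))))
      (by ring) ((neg_le_neg h4).trans (le_of_eq (by ring)))
  have hrem : L * (τ ^ 2 * (1 + |x|) ^ (2 * n + 1 + 1)) ≤
      L * (2 * K / min q b) ^ 2 * 2 ^ (2 * n + 1) * v ^ 2 / A ^ 2 * (1 + x ^ (2 * n + 2)) := by
    calc _ ≤ L * (τ ^ 2 * (2 ^ (2 * n + 1) * (1 + x ^ (2 * n + 2)))) := by gcongr
      _ = _ := by
        rw [hτ2]
        ring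
  push_cast at key
  have hsplit : (2 * (n : ℝ) + 1 + 1) * (x ^ (2 * n + 1) * (v / r * (m + a * z))) =
      (2 * n + 2) * (x ^ (2 * n + 1) * (v / r * m)) +
      (2 * n + 2) * x ^ (2 * n + 1) * v * r⁻¹ * a * z := by
    rw [div_eq_mul_inv]
    ring
  have h22 : 2 * n + 1 + 1 = 2 * n + 2 := rfl
  rw [h22] at key hrem
  linarith

lemma exists_energy_mul_moment_le [IsProbabilityMeasure μ]
    (H : RecursiveError μ ℱ v X Q β m a Z q b B c K V)
    (hA : Tendsto (energy v) atTop atTop) {n : ℕ} (hn : 3 * max q B ≤ (2 * n + 2) * c) :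
    ∃ C : ℝ, 0 ≤ C ∧ ∀ k, energy v k * ∫ ω, X k ω ^ (2 * n + 2) ∂μ ≤ C := by
  obtain ⟨C, hC, hb⟩ := H.exists_pow_step_bound hn
  refine exists_mul_le_of_contraction (v := v) (U := V ^ 2) (C := C)
    (fun k => integral_nonneg fun ω => Even.pow_nonneg ⟨n + 1, by ring⟩ _)
    (one_le_energy v) (energy_succ v) hA (fun k => ?_) hC fun k => ?_
  · rw [← sq_abs]
    exact pow_le_pow_left₀ (abs_nonneg _) (H.abs_v_le k) 2
  · have hY : BddMeasurable (ℱ k) fun ω =>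
        (2 * n + 2) * X k ω ^ (2 * n + 1) * v k * (Q (k + 1) ω)⁻¹ * a k ω :=
      ((((BddMeasurable.const _).mul ((H.bdd_X k).pow _)).mul (.const _)).mul
        ((H.bdd_Q_succ k).inv H.min_pos (H.min_le_Q (k + 1)))).mul (H.bdd_a k)
    exact integral_le_of_forall_le
      ((((H.bdd_X (k + 1)).mono (H.sigma_le _)).pow _).integrable μ)
      ((((H.bdd_X k).mono (H.sigma_le _)).pow _).integrable μ)
      (((hY.mono (H.sigma_le k)).mul (H.bdd_Z k)).integrable μ)
      (H.integral_mul_Z k _ hY) (hb k)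

/-- Multiplying the error by `Q` turns its contraction into exact cancellation of the linear drift.
The factor `1 / 2` in the growth rate is what `exists_le_mul_of_growth` needs. -/
lemma exists_sq_step_bound (H : RecursiveError μ ℱ v X Q β m a Z q b B c K V) {n : ℕ}
    (hn : 1 ≤ n) :
    ∃ C : ℝ, 0 ≤ C ∧ ∀ k ω, (Q (k + 1) ω * X (k + 1) ω) ^ 2 ≤
      (1 + v k ^ 2 / (2 * energy v k)) * (Q k ω * X k ω) ^ 2 +
      C * v k ^ 2 * (1 + energy v k * X k ω ^ (2 * n + 2)) +
      2 * (Q k ω * X k ω + (β k ω * v k ^ 2 * X k ω + v k * m k ω)) * v k * a k ω * Z k ω := by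
  have hc0 := H.min_pos
  have hK := H.K_pos
  have hC0 : 0 < max q B := H.q_pos.trans_le (le_max_left _ _)
  have hV : 0 ≤ V := (abs_nonneg _).trans (H.abs_v_le 0)
  -- Chosen so that the `ε * x ^ 2` part of the cubic term is exactly `v ^ 2 / (2 * A) * (min q b *
  -- A * x) ^ 2`, which `Q ≥ min q b * A` bounds.
  set ε := min q b ^ 2 / (4 * max q B * K) with hε
  have hε0 : 0 < ε := by positivity
  refine ⟨2 * max q B * K / ε ^ (2 * n + 2 - 3) + K ^ 2 * V ^ 2 + 4 * K ^ 2, by positivity,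
    fun k ω => ?_⟩
  have hA1 : 1 ≤ energy v k := one_le_energy v k
  have hq1 := (H.Q_pos (k + 1) ω).ne'
  have hq0 := H.Q_pos k ω
  have hqA := H.le_max_mul_energy k ω
  have hAq := H.min_mul_energy_le k ω
  have hrec : Q (k + 1) ω * X (k + 1) ω = Q k ω * X k ω +
      (β k ω * v k ^ 2 * X k ω + v k * m k ω) + v k * a k ω * Z k ω := by
    rw [H.X_succ k ω]
    have : Q (k + 1) ω * (X k ω + v k / Q (k + 1) ω * (m k ω + a k ω * Z k ω)) =
        Q (k + 1) ω * X k ω + v k * (m k ω + a k ω * Z k ω) := by field_simp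
    rw [this, H.Q_succ k ω]
    ring
  have ha := H.abs_a_le k ω
  have hZ := H.abs_Z_le k ω
  have hD := H.linearization k ω
  have hv := H.abs_v_le k
  rw [hrec]
  generalize β k ω * v k ^ 2 * X k ω + v k * m k ω = D at *
  generalize X k ω = x at *
  generalize Q k ω = r at *
  generalize a k ω = a at *
  generalize Z k ω = z at *
  generalize energy v k = A at *
  generalize v k = v at *
  have hA0 : 0 < A := by linarith
  have hp : (0 : ℝ) ≤ x ^ (2 * n + 2) := Even.pow_nonneg ⟨n + 1, by ring⟩ x
  have hpabs : |x| ^ (2 * n + 2) = x ^ (2 * n + 2) := Even.pow_abs ⟨n + 1, by ring⟩ x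
  have hpA : x ^ (2 * n + 2) ≤ A * x ^ (2 * n + 2) := le_mul_of_one_le_left hp hA1
  have hv2 : v ^ 2 ≤ V ^ 2 := by
    rw [← sq_abs]
    exact pow_le_pow_left₀ (abs_nonneg _) hv 2
  have hv0 := sq_nonneg v
  have hcross : 2 * (r * x) * D ≤ v ^ 2 / (2 * A) * (r * x) ^ 2 +
      2 * max q B * K / ε ^ (2 * n + 2 - 3) * v ^ 2 * (A * x ^ (2 * n + 2)) := by
    have h1 : 2 * (r * x) * D ≤ 2 * (max q B * A * |x|) * (K * (v ^ 2 * x ^ 2)) := by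
      refine (le_abs_self _).trans ?_
      rw [abs_mul, abs_mul, abs_mul, abs_of_pos hq0, abs_two]
      gcongr
    have h2 : 2 * (max q B * A * |x|) * (K * (v ^ 2 * x ^ 2)) =
        2 * max q B * K * A * v ^ 2 * |x| ^ 3 := by
      rw [← sq_abs x]
      ring
    have h3 := mul_le_mul_of_nonneg_left (abs_cube_le hε0 (by lia : 3 ≤ 2 * n + 2) x)
      (by positivity : 0 ≤ 2 * max q B * K * A * v ^ 2)
    rw [hpabs] at h3
    have h4 : 2 * max q B * K * A * v ^ 2 * (ε * x ^ 2) =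
        v ^ 2 / (2 * A) * ((min q b * A) ^ 2 * x ^ 2) := by
      rw [hε]
      field_simp
      ring
    have h5 : v ^ 2 / (2 * A) * ((min q b * A) ^ 2 * x ^ 2) ≤ v ^ 2 / (2 * A) * (r * x) ^ 2 := by
      rw [mul_pow r x]
      gcongr
    rw [h2] at h1
    rw [mul_add, h4] at h3
    refine h1.trans (h3.trans ?_)
    refine add_le_add h5 (le_of_eq ?_)
    ring
  have hDD : D ^ 2 ≤ K ^ 2 * V ^ 2 * v ^ 2 * (1 + A * x ^ (2 * n + 2)) := by
    have h1 : x ^ 4 ≤ 1 + A * x ^ (2 * n + 2) := by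
      have := pow_le_one_add_pow (abs_nonneg x) (by lia : 4 ≤ 2 * n + 2)
      rw [hpabs, Even.pow_abs (show Even 4 from ⟨2, rfl⟩)] at this
      linarith
    calc D ^ 2 = |D| ^ 2 := (sq_abs D).symm
      _ ≤ (K * (v ^ 2 * x ^ 2)) ^ 2 := by gcongr
      _ = K ^ 2 * v ^ 2 * v ^ 2 * x ^ 4 := by ring
      _ ≤ K ^ 2 * V ^ 2 * v ^ 2 * (1 + A * x ^ (2 * n + 2)) := by gcongr
  have hN : (v * a * z) ^ 2 ≤ 4 * K ^ 2 * v ^ 2 * (1 + A * x ^ (2 * n + 2)) := by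
    have h1 : x ^ 2 ≤ 1 + A * x ^ (2 * n + 2) := by
      have := pow_le_one_add_pow (abs_nonneg x) (by lia : 2 ≤ 2 * n + 2)
      rw [hpabs, sq_abs] at this
      linarith
    have h2 : (1 + |x|) ^ 2 ≤ 4 * (1 + A * x ^ (2 * n + 2)) := by
      have h3 : 0 ≤ A * x ^ (2 * n + 2) := by positivity
      nlinarith [sq_nonneg (1 - |x|), sq_abs x]
    calc (v * a * z) ^ 2 = v ^ 2 * |a| ^ 2 * |z| ^ 2 := by
          rw [sq_abs, sq_abs]
          ring
      _ ≤ v ^ 2 * (K * (1 + |x|)) ^ 2 * 1 ^ 2 := by gcongr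
      _ = K ^ 2 * v ^ 2 * (1 + |x|) ^ 2 := by ring
      _ ≤ K ^ 2 * v ^ 2 * (4 * (1 + A * x ^ (2 * n + 2))) := by gcongr
      _ = _ := by ring
  have hextra : 0 ≤ 2 * max q B * K / ε ^ (2 * n + 2 - 3) * v ^ 2 := by positivity
  have hexp : (r * x + D + v * a * z) ^ 2 = (r * x) ^ 2 + 2 * (r * x) * D + D ^ 2 +
      (v * a * z) ^ 2 + 2 * (r * x + D) * v * a * z := by ring
  rw [hexp]
  linarith

theorem exists_energy_mul_integral_sq_le [IsProbabilityMeasure μ]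
    (H : RecursiveError μ ℱ v X Q β m a Z q b B c K V)
    (hA : Tendsto (energy v) atTop atTop) :
    ∃ C : ℝ, 0 ≤ C ∧ ∀ k, energy v k * ∫ ω, X k ω ^ 2 ∂μ ≤ C := by
  -- `hn` makes the high moment contract fast enough; `1 ≤ n` makes its order at least 4, as the
  -- cubic and `D ^ 2` bounds require.
  obtain ⟨n, hn1, hn⟩ : ∃ n : ℕ, 1 ≤ n ∧ 3 * max q B ≤ (2 * n + 2) * c := by
    obtain ⟨n, hn⟩ := exists_nat_ge (3 * max q B / c)
    refine ⟨n + 1, by lia, ?_⟩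
    rw [div_le_iff₀ H.c_pos] at hn
    have := H.c_pos
    push_cast
    nlinarith [mul_nonneg (Nat.cast_nonneg (α := ℝ) n) this.le]
  obtain ⟨W, hW, hWb⟩ := H.exists_energy_mul_moment_le hA hn
  obtain ⟨C, hC, hb⟩ := H.exists_sq_step_bound hn1
  have bX := fun k => (H.bdd_X k).mono (H.sigma_le k)
  have bQ := fun k => (H.bdd_Q k).mono (H.sigma_le k)
  obtain ⟨G, hG, hGb⟩ := exists_le_mul_of_growth (v := v) (C := C * (1 + W))
    (u := fun k => ∫ ω, (Q k ω * X k ω) ^ 2 ∂μ)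
    (one_le_energy v) (energy_succ v) (integral_nonneg fun ω => sq_nonneg _) (by positivity)
    fun k => by
      have hY : BddMeasurable (ℱ k) fun ω =>
          2 * (Q k ω * X k ω + (β k ω * v k ^ 2 * X k ω + v k * m k ω)) * v k * a k ω :=
        ((((BddMeasurable.const _).mul (((H.bdd_Q k).mul (H.bdd_X k)).add
          ((((H.bdd_β k).mul (.const _)).mul (H.bdd_X k)).add
            ((BddMeasurable.const _).mul (H.bdd_m k))))).mul (.const _)).mul (H.bdd_a k))
      have hint := (((bX k).pow (2 * n + 2)).integrable μ)
      have hNint := ((hY.mono (H.sigma_le k)).mul (H.bdd_Z k)).integrable μ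
      have hR : Integrable (fun ω => C * v k ^ 2 * (1 + energy v k * X k ω ^ (2 * n + 2))) μ :=
        ((integrable_const _).add (hint.const_mul _)).const_mul _
      have hSint := (((bQ k).mul (bX k)).pow 2).integrable μ
      have hS : Integrable (fun ω => (1 + v k ^ 2 / (2 * energy v k)) *
        (Q k ω * X k ω) ^ 2) μ := hSint.const_mul _
      calc ∫ ω, (Q (k + 1) ω * X (k + 1) ω) ^ 2 ∂μ ≤ _ :=
            integral_mono ((((bQ (k + 1)).mul (bX (k + 1))).pow 2).integrable μ)
              ((hS.add hR).add hNint) (hb k)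
        _ = (1 + v k ^ 2 / (2 * energy v k)) * ∫ ω, (Q k ω * X k ω) ^ 2 ∂μ +
            C * v k ^ 2 * (1 + energy v k * ∫ ω, X k ω ^ (2 * n + 2) ∂μ) := by
          have h1 := integral_add (hS.add hR) hNint
          have h2 := integral_add hS hR
          have h3 := integral_add (integrable_const (μ := μ) (1 : ℝ))
            (hint.const_mul (energy v k))
          simp only [Pi.add_apply] at h1 h2 h3
          refine h1.trans ?_
          rw [h2, H.integral_mul_Z k _ hY, integral_const_mul, integral_const_mul, h3,
            integral_const_mul]
          simp
        _ ≤ (1 + v k ^ 2 / (2 * energy v k)) * ∫ ω, (Q k ω * X k ω) ^ 2 ∂μ +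
            C * v k ^ 2 * (1 + W) := by
          gcongr
          exact hWb k
        _ = _ := by ring
  have hc0 := H.min_pos
  refine ⟨G / min q b ^ 2, by positivity, fun k => ?_⟩
  have hA0 : 0 < energy v k := by linarith [one_le_energy v k]
  have h1 : (min q b * energy v k) ^ 2 * ∫ ω, X k ω ^ 2 ∂μ ≤ G * energy v k := by
    refine le_trans ?_ (hGb k)
    rw [← integral_const_mul]
    refine integral_mono ((((bX k).pow 2).integrable μ).const_mul _)
      ((((bQ k).mul (bX k)).pow 2).integrable μ) fun ω => ?_
    simp only [mul_pow (Q k ω)]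
    have := H.min_mul_energy_le k ω
    gcongr
  rw [le_div_iff₀ (by positivity)]
  refine le_of_mul_le_mul_right ?_ hA0
  linarith

end RecursiveError

/-! ### Persistent excitation and the structure of the recursion -/

namespace IMPF

/-- Each block of `N` inputs adds at least `N * δ ^ 2`; before a full block is available, the
initial 1 in `energy` suffices, whence the `1 / N`. -/
lemma exists_mul_le_energy {φ : ℕ → ℝ} (hφ : InputAssumption φ) :
    ∃ c : ℝ, 0 < c ∧ ∀ k : ℕ, c * k ≤ energy (fun i => φ (i + 1)) k := by
  obtain ⟨N, hN, δ, hδ, h⟩ := hφ.excitation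
  have hN0 : (0 : ℝ) < N := by exact_mod_cast hN
  refine ⟨min (δ ^ 2) (1 / N), lt_min (by positivity) (by positivity), fun k => ?_⟩
  induction k using Nat.strong_induction_on with
  | _ k ih =>
    rcases Nat.lt_or_ge k N with hk | hk
    · have hkN : (k : ℝ) ≤ N := by exact_mod_cast hk.le
      calc min (δ ^ 2) (1 / (N : ℝ)) * k ≤ 1 / N * N := by
            gcongr
            exact min_le_right _ _
        _ = 1 := by field_simp
        _ ≤ _ := one_le_energy _ _
    · obtain ⟨j, rfl⟩ := Nat.exists_eq_add_of_le' hk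
      have hj := ih j (by lia)
      have hex := h (j + 1) (by lia)
      rw [one_div, inv_mul_eq_div, le_div_iff₀ hN0] at hex
      have hsum : ∑ i ∈ Finset.Ico (j + 1) (j + 1 + N), φ i ^ 2 =
          ∑ i ∈ Finset.range N, φ (j + i + 1) ^ 2 := by
        rw [Finset.sum_Ico_eq_sum_range, Nat.add_sub_cancel_left]
        exact Finset.sum_congr rfl fun i _ => by rw [add_right_comm]
      have henergy : energy (fun i => φ (i + 1)) (j + N) =
          energy (fun i => φ (i + 1)) j + ∑ i ∈ Finset.range N, φ (j + i + 1) ^ 2 := by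
        unfold energy
        rw [Finset.sum_range_add, add_assoc]
      rw [henergy, ← hsum]
      push_cast
      rw [mul_add]
      exact add_le_add hj ((mul_le_mul_of_nonneg_right (min_le_left _ _) hN0.le).trans hex)

lemma tendsto_energy_atTop {φ : ℕ → ℝ} (hφ : InputAssumption φ) :
    Tendsto (energy fun i => φ (i + 1)) atTop atTop := by
  obtain ⟨c, hc, h⟩ := exists_mul_le_energy hφ
  exact tendsto_atTop_mono h (tendsto_natCast_atTop_atTop.const_mul_atTop hc)

/-- Information form of the gain update: reciprocals add. -/
lemma updateP_eq {b u P : ℝ} (hb : 0 ≤ b) (hP : 0 < P) :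
    updateP b u P = (P⁻¹ + b * u ^ 2)⁻¹ := by
  have h1 : 0 < 1 + b * u * P * u := by
    have : b * u * P * u = b * u ^ 2 * P := by ring
    rw [this]
    positivity
  have h2 : 0 < P⁻¹ + b * u ^ 2 := by positivity
  unfold updateP
  field_simp
  ring

lemma run_P_pos {σ : ℝ≥0} (hσ : 0 < σ) (C M : ℝ) (φ s : ℕ → ℝ) (θ₀ : ℝ) {P₀ : ℝ}
    (hP₀ : 0 < P₀) (k : ℕ) : 0 < (run σ C M φ s θ₀ P₀ k).P := by
  induction k with
  | zero => exact hP₀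
  | succ k ih =>
    have hβ := (betaHat_pos hσ C (cutoff M (φ (k + 1) * (run σ C M φ s θ₀ P₀ k).est))).le
    have h : 0 < updateP (betaHat σ C (cutoff M (φ (k + 1) * (run σ C M φ s θ₀ P₀ k).est)))
        (φ (k + 1)) (run σ C M φ s θ₀ P₀ k).P := by
      rw [updateP_eq hβ ih]
      positivity
    exact h

lemma run_congr (σ : ℝ≥0) (C M : ℝ) (φ : ℕ → ℝ) {s s' : ℕ → ℝ}
    (h : ∀ k, s (k + 1) = s' (k + 1)) (θ₀ P₀ : ℝ) (k : ℕ) :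
    run σ C M φ s θ₀ P₀ k = run σ C M φ s' θ₀ P₀ k := by
  induction k with
  | zero => rfl
  | succ k ih => rw [run, run, ih, h]

lemma measurable_cutoff (M : ℝ) : Measurable (cutoff M) := by
  unfold cutoff
  exact Measurable.ite measurableSet_Ioi measurable_const
    (Measurable.ite measurableSet_Iio measurable_const measurable_id)

lemma measurable_accel (M : ℝ) : Measurable (accel M) := by
  unfold accel
  exact Measurable.ite (measurableSet_le (by fun_prop) measurable_const) measurable_const
    (by fun_prop)

lemma measurable_meanInnovation {σ : ℝ≥0} (hσ : 0 < σ) (C M y : ℝ) :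
    Measurable fun t => meanInnovation σ C M t y := by
  unfold meanInnovation
  have h1 := measurable_cutoff M
  have h2 := (continuous_noiseCDF hσ).measurable
  exact ((measurable_accel M).mul ((continuous_alphaHat hσ C).measurable.comp h1)).mul
    ((h2.comp (h1.const_sub C)).sub_const _)

/-! ### Observations, their independence and the reduction to the abstract estimator -/

lemma measurable_observation {Ω : Type*} [MeasurableSpace Ω] (C : ℝ) (φ : ℕ → ℝ) (θ : ℝ)
    {d : ℕ → Ω → ℝ} (hd : ∀ k, Measurable (d k)) (k : ℕ) :
    Measurable (observation C φ θ d k) := by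
  unfold observation output
  exact Measurable.ite (measurableSet_le ((hd k).const_add _) measurable_const)
    measurable_const measurable_const

lemma observation_mem_Icc {Ω : Type*} (C : ℝ) (φ : ℕ → ℝ) (θ : ℝ) (d : ℕ → Ω → ℝ) (k : ℕ)
    (ω : Ω) : observation C φ θ d k ω ∈ Set.Icc (0 : ℝ) 1 := by
  unfold observation
  split_ifs <;> simp

lemma integral_observation {Ω : Type*} [MeasurableSpace Ω] {μ : Measure Ω} {σ : ℝ≥0}
    (C : ℝ) (φ : ℕ → ℝ) (θ : ℝ) {d : ℕ → Ω → ℝ} {k : ℕ} (hdm : Measurable (d k))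
    (hd : HasLaw (d k) (gaussianReal 0 (σ ^ 2)) μ) :
    ∫ ω, observation C φ θ d k ω ∂μ = noiseCDF σ (C - φ k * θ) := by
  have h : observation C φ θ d k = (d k ⁻¹' Set.Iic (C - φ k * θ)).indicator 1 := by
    ext ω
    by_cases hω : φ k * θ + d k ω ≤ C
    · rw [observation, output, if_pos hω, Set.indicator_of_mem (by
        change d k ω ≤ _
        linarith)]
      rfl
    · rw [observation, output, if_neg hω, Set.indicator_of_notMem fun h => hω (by
        have : d k ω ≤ C - φ k * θ := h
        linarith)]
  rw [h, integral_indicator_one (hdm measurableSet_Iic), noiseCDF, cdf_eq_real, ← hd.map_eq,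
    map_measureReal_apply hdm measurableSet_Iic]

/-- The information contained in the observations `s_1, …, s_k`. -/
abbrev observationSigma {Ω : Type*} (s : ℕ → Ω → ℝ) (k : ℕ) : MeasurableSpace Ω :=
  ⨆ j ∈ {j : ℕ | j < k}, MeasurableSpace.comap (s (j + 1)) inferInstance

/-- The next observation is independent of the past ones, so the integral factors and the centred
factor has mean zero. -/
lemma integral_mul_eq_zero_of_observationSigma {Ω : Type*} [MeasurableSpace Ω] {μ : Measure Ω}
    [IsProbabilityMeasure μ] {s : ℕ → Ω → ℝ} (hs : ∀ k, Measurable (s k))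
    (hind : iIndepFun (fun k => s (k + 1)) μ) {k : ℕ} {Y : Ω → ℝ}
    (hY : Measurable[observationSigma s k] Y) {F : ℝ} (hF : ∫ ω, s (k + 1) ω ∂μ = F)
    (hint : Integrable (s (k + 1)) μ) :
    ∫ ω, Y ω * (F - s (k + 1) ω) ∂μ = 0 := by
  have h1 : Indep (observationSigma s k)
      (⨆ j ∈ ({k} : Set ℕ), MeasurableSpace.comap (s (j + 1)) inferInstance) μ :=
    indep_iSup_of_disjoint (fun j => (hs (j + 1)).comap_le) hind (by simp)
  rw [iSup_singleton] at h1
  have hle : observationSigma s k ≤ ‹MeasurableSpace Ω› :=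
    iSup₂_le fun j _ => (hs (j + 1)).comap_le
  have h2 : IndepFun Y (s (k + 1)) μ :=
    indep_of_indep_of_le_left h1 hY.comap_le
  have h3 : IndepFun Y (fun ω => F - s (k + 1) ω) μ :=
    h2.comp (φ := id) (ψ := fun x => F - x) measurable_id (by fun_prop)
  rw [h3.integral_fun_mul_eq_mul_integral (hY.mono hle le_rfl).aestronglyMeasurable
    ((hs (k + 1)).const_sub F).aestronglyMeasurable, integral_sub (integrable_const F) hint, hF]
  simp

/-- The error of the IMPF algorithm is a recursive error in the sense of `RecursiveError`. -/
lemma exists_recursiveError {Ω : Type*} [MeasurableSpace Ω] (μ : Measure Ω)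
    [IsProbabilityMeasure μ] (C : ℝ) {θ θbar : ℝ} (hθ : |θ| ≤ θbar) {σ : ℝ≥0} (hσ : 0 < σ)
    {d : ℕ → Ω → ℝ} (hdm : ∀ k, Measurable (d k)) (hd : NoiseAssumption μ σ d) {φ : ℕ → ℝ}
    (hφ : InputAssumption φ) (θ₀ : ℝ) {P₀ : ℝ} (hP₀ : 0 < P₀) :
    ∃ (ℱ : ℕ → MeasurableSpace Ω) (Q β m a Z : ℕ → Ω → ℝ) (q b B c K V : ℝ),
      RecursiveError μ ℱ (fun k => φ (k + 1))
        (fun k ω => estimate σ C θbar φ θ d θ₀ P₀ k ω - θ) Q β m a Z q b B c K V := by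
  set s := observation C φ θ d with hs
  set M := cutoffLevel φ θbar with hM
  set V := inputSup φ with hV
  have hvV : ∀ k, |φ (k + 1)| ≤ V := le_ciSup hφ.bdd
  have hV0 : 0 ≤ V := (abs_nonneg _).trans (hvV 0)
  have hy : ∀ k, |φ (k + 1) * θ| ≤ M - 2 := fun k => by
    rw [abs_mul, hM, cutoffLevel, add_sub_cancel_right]
    exact mul_le_mul (hvV k) hθ (abs_nonneg _) hV0
  have hM0 : 0 ≤ M := by linarith [hy 0, abs_nonneg (φ (0 + 1) * θ)]
  have hsm : ∀ k, Measurable (s k) := measurable_observation C φ θ hdm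
  have hs01 : ∀ k ω, s k ω ∈ Set.Icc (0 : ℝ) 1 := observation_mem_Icc C φ θ d
  have hsind : iIndepFun (fun k => s (k + 1)) μ :=
    hd.indep.comp (fun k x => if φ (k + 1) * θ + x ≤ C then 1 else 0) fun k =>
      Measurable.ite (measurableSet_le (by fun_prop) measurable_const) measurable_const
        measurable_const
  obtain ⟨_, α, _, hα, hαb⟩ := exists_bounds_on_Icc (continuous_alphaHat hσ C)
    (alphaHat_pos hσ C) (-M) M
  obtain ⟨b, B, hb, hB, hβb⟩ := exists_bounds_on_Icc (continuous_betaHat hσ C)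
    (betaHat_pos hσ C) (-M) M
  obtain ⟨c, hc, hcb⟩ := exists_meanInnovation_mul_le hσ C (M := M)
  obtain ⟨L, hL, hLb⟩ := exists_linearization_bound hσ C (M := M)
  set S : ℕ → Ω → State := fun k ω => run σ C M φ (fun j => s j ω) θ₀ P₀ k with hS
  set X : ℕ → Ω → ℝ := fun k ω => (S k ω).est - θ with hX
  set Q : ℕ → Ω → ℝ := fun k ω => ((S k ω).P)⁻¹ with hQ
  set β : ℕ → Ω → ℝ := fun k ω => betaHat σ C (cutoff M (φ (k + 1) * (S k ω).est)) with hβ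
  set m : ℕ → Ω → ℝ := fun k ω =>
    meanInnovation σ C M (φ (k + 1) * (S k ω).est) (φ (k + 1) * θ) with hm
  set a : ℕ → Ω → ℝ := fun k ω => accel M (φ (k + 1) * (S k ω).est) *
    alphaHat σ C (cutoff M (φ (k + 1) * (S k ω).est)) with ha
  set Z : ℕ → Ω → ℝ := fun k ω => noiseCDF σ (C - φ (k + 1) * θ) - s (k + 1) ω with hZ
  -- One constant for the noise amplitude, the drift and the linearization; the 1 ensures
  -- positivity.
  set K := α * (1 + V + V * |θ|) + V * L + 1 with hK
  have hK0 : 0 < K := by positivity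
  have hz : ∀ x, cutoff M x ∈ Set.Icc (-M) M := fun x => abs_le.1 (abs_cutoff_le hM0 x)
  have hPpos : ∀ k ω, 0 < (S k ω).P := fun k ω => run_P_pos hσ C M φ _ θ₀ hP₀ k
  have hbβ : ∀ k ω, b ≤ β k ω := fun k ω => (hβb _ (hz _)).1
  have hβB : ∀ k ω, β k ω ≤ B := fun k ω => (hβb _ (hz _)).2
  have hP' : ∀ k ω, (S (k + 1) ω).P = updateP (β k ω) (φ (k + 1)) (S k ω).P := fun k ω => rfl
  have hQ0 : ∀ ω, Q 0 ω = P₀⁻¹ := fun ω => rfl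
  have hQs : ∀ k ω, Q (k + 1) ω = Q k ω + β k ω * φ (k + 1) ^ 2 := fun k ω => by
    simp only [hQ]
    rw [hP', updateP_eq (hb.le.trans (hbβ k ω)) (hPpos k ω), inv_inv]
  have hXs : ∀ k ω, X (k + 1) ω = X k ω + φ (k + 1) / Q (k + 1) ω *
      (m k ω + a k ω * Z k ω) := fun k ω => by
    have hest : (S (k + 1) ω).est = (S k ω).est + (S (k + 1) ω).P * φ (k + 1) *
      accel M (φ (k + 1) * (S k ω).est) * alphaHat σ C (cutoff M (φ (k + 1) * (S k ω).est)) *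
      (noiseCDF σ (C - cutoff M (φ (k + 1) * (S k ω).est)) - s (k + 1) ω) := rfl
    simp only [hX, hQ, hm, ha, hZ, meanInnovation]
    rw [hest, div_inv_eq_mul]
    ring
  have haX : ∀ k ω, |a k ω| ≤ K * (1 + |X k ω|) := fun k ω => by
    have h1 := accel_le M (φ (k + 1) * (S k ω).est)
    have h2 : |φ (k + 1) * (S k ω).est| ≤ V * (|X k ω| + |θ|) := by
      rw [abs_mul]
      refine mul_le_mul (hvV k) ?_ (abs_nonneg _) hV0
      simpa [hX] using abs_add_le ((S k ω).est - θ) θ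
    have h3 := (hαb _ (hz (φ (k + 1) * (S k ω).est))).2
    have h4 := (alphaHat_pos hσ C (cutoff M (φ (k + 1) * (S k ω).est))).le
    have h5 := accel_nonneg M (φ (k + 1) * (S k ω).est)
    have hXa := abs_nonneg (X k ω)
    simp only [ha]
    rw [abs_of_nonneg (mul_nonneg h5 h4)]
    calc _ ≤ (1 + V * (|X k ω| + |θ|)) * α :=
          mul_le_mul (h1.trans (by linarith)) h3 h4 (by positivity)
      _ ≤ α * (1 + V + V * |θ|) * (1 + |X k ω|) := by
          have : 0 ≤ α * (V + |X k ω| + V * |θ| * |X k ω|) := by positivity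
          linarith
      _ ≤ K * (1 + |X k ω|) := by
          refine mul_le_mul_of_nonneg_right ?_ (by positivity)
          have : 0 ≤ V * L := by positivity
          linarith
  have hma : ∀ k ω, |m k ω| ≤ |a k ω| := fun k ω => by
    simp only [hm, ha, meanInnovation]
    rw [abs_mul]
    exact mul_le_of_le_one_right (abs_nonneg _) (abs_noiseCDF_sub_le_one σ _ _)
  have hZ1 : ∀ k ω, |Z k ω| ≤ 1 := fun k ω => by
    have h1 := noiseCDF_pos hσ (C - φ (k + 1) * θ)
    have h2 := noiseCDF_lt_one hσ (C - φ (k + 1) * θ)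
    obtain ⟨h3, h4⟩ := hs01 (k + 1) ω
    exact abs_le.2 ⟨by simp only [hZ]; linarith, by simp only [hZ]; linarith⟩
  have hle : ∀ k, observationSigma s k ≤ ‹MeasurableSpace Ω› := fun k =>
    iSup₂_le fun j _ => (hsm (j + 1)).comap_le
  have hmono : ∀ k, observationSigma s k ≤ observationSigma s (k + 1) := fun k =>
    biSup_mono fun j hj => Nat.lt_succ_of_lt hj
  have hZF : ∀ k, BddMeasurable (observationSigma s (k + 1)) (Z k) := fun k => by
    refine ⟨?_, 1, hZ1 k⟩
    have h1 : Measurable[observationSigma s (k + 1)] (s (k + 1)) :=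
      (comap_measurable (s (k + 1))).mono
        (le_iSup₂_of_le (f := fun j (_ : j ∈ {j : ℕ | j < k + 1}) =>
          MeasurableSpace.comap (s (j + 1)) inferInstance) k (Nat.lt_succ_self k) le_rfl) le_rfl
    exact h1.const_sub _
  have hcoef : ∀ k, BddMeasurable (observationSigma s k) (X k) →
      BddMeasurable (observationSigma s k) (β k) ∧ BddMeasurable (observationSigma s k) (m k) ∧
      BddMeasurable (observationSigma s k) (a k) := fun k hXk => by
    obtain ⟨E, hE⟩ := hXk.2
    have hest : Measurable[observationSigma s k] fun ω => φ (k + 1) * (S k ω).est := by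
      have h1 : (fun ω => φ (k + 1) * (S k ω).est) = fun ω => φ (k + 1) * (X k ω + θ) := by
        simp [hX]
      rw [h1]
      exact (hXk.1.add_const θ).const_mul _
    have haE : ∀ ω, |a k ω| ≤ K * (1 + E) := fun ω => (haX k ω).trans (by
      have := hE ω
      gcongr)
    have hcut := (measurable_cutoff M).comp hest
    refine ⟨⟨(continuous_betaHat hσ C).measurable.comp hcut, B, fun ω => ?_⟩,
      ⟨(measurable_meanInnovation hσ C M _).comp hest, _, fun ω => (hma k ω).trans (haE ω)⟩,
      ⟨((measurable_accel M).comp hest).mul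
        ((continuous_alphaHat hσ C).measurable.comp hcut), _, haE⟩⟩
    rw [abs_of_nonneg (hb.le.trans (hbβ k ω))]
    exact hβB k ω
  -- Bounds at each fixed `k`, not uniform in `k`: they serve only integrability. The lower bound on
  -- `Q` keeps the next gain bounded.
  have hXQ : ∀ k, BddMeasurable (observationSigma s k) (X k) ∧
      BddMeasurable (observationSigma s k) (Q k) ∧ ∀ ω, P₀⁻¹ ≤ Q k ω := fun k => by
    induction k with
    | zero => exact ⟨.const (θ₀ - θ), .const P₀⁻¹, fun ω => le_rfl⟩
    | succ k ih =>
      obtain ⟨ihX, ihQ, ihP⟩ := ih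
      obtain ⟨hβk, hmk, hak⟩ := hcoef k ihX
      have hQ1 : BddMeasurable (observationSigma s (k + 1)) (Q (k + 1)) := by
        rw [funext (hQs k)]
        exact (ihQ.add (hβk.mul (.const _))).mono (hmono k)
      have hP1 : ∀ ω, P₀⁻¹ ≤ Q (k + 1) ω := fun ω => by
        rw [hQs]
        have := ihP ω
        have : 0 ≤ β k ω * φ (k + 1) ^ 2 :=
          mul_nonneg (hb.le.trans (hbβ k ω)) (sq_nonneg _)
        linarith
      refine ⟨?_, hQ1, hP1⟩
      rw [funext (hXs k)]
      simp only [div_eq_mul_inv]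
      exact (ihX.mono (hmono k)).add (((BddMeasurable.const _).mul
        (hQ1.inv (inv_pos.2 hP₀) hP1)).mul
        ((hmk.mono (hmono k)).add ((hak.mono (hmono k)).mul (hZF k))))
  have hdiff : ∀ k ω, φ (k + 1) * (S k ω).est - φ (k + 1) * θ = φ (k + 1) * X k ω :=
    fun k ω => (mul_sub _ _ _).symm
  refine ⟨observationSigma s, Q, β, m, a, Z, P₀⁻¹, b, B, c, K, V, ?_⟩
  exact
    { q_pos := inv_pos.2 hP₀
      b_pos := hb
      c_pos := hc
      K_pos := hK0
      sigma_le := hle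
      bdd_X := fun k => (hXQ k).1
      bdd_Q := fun k => (hXQ k).2.1
      bdd_β := fun k => (hcoef k (hXQ k).1).1
      bdd_m := fun k => (hcoef k (hXQ k).1).2.1
      bdd_a := fun k => (hcoef k (hXQ k).1).2.2
      bdd_Z := fun k => (hZF k).mono (hle (k + 1))
      integral_mul_Z := fun k Y hY =>
        integral_mul_eq_zero_of_observationSigma hsm hsind hY.1
          (integral_observation C φ θ (hdm (k + 1)) (hd.law (k + 1) (by lia)))
          (Integrable.of_bound (hsm (k + 1)).aestronglyMeasurable 1
            (Eventually.of_forall fun ω => by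
              rw [Real.norm_eq_abs, abs_of_nonneg (hs01 (k + 1) ω).1]
              exact (hs01 (k + 1) ω).2))
      abs_Z_le := hZ1
      Q_zero := hQ0
      Q_succ := hQs
      le_β := hbβ
      β_le := hβB
      X_succ := hXs
      abs_a_le := haX
      abs_m_le := fun k ω => (hma k ω).trans (haX k ω)
      drift := fun k ω => by
        have h := hcb (φ (k + 1) * (S k ω).est) _ (hy k)
        rw [hdiff, mul_pow] at h
        calc φ (k + 1) * m k ω * X k ω = m k ω * (φ (k + 1) * X k ω) := by ring
          _ ≤ _ := h
      linearization := fun k ω => by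
        have h := hLb (φ (k + 1) * (S k ω).est) _ (hy k)
        rw [hdiff, mul_pow] at h
        have h1 : β k ω * φ (k + 1) ^ 2 * X k ω + φ (k + 1) * m k ω =
            φ (k + 1) * (β k ω * (φ (k + 1) * X k ω) + m k ω) := by ring
        have h2 : 0 ≤ φ (k + 1) ^ 2 * X k ω ^ 2 := by positivity
        change |β k ω * φ (k + 1) ^ 2 * X k ω + φ (k + 1) * m k ω| ≤ _
        rw [h1, abs_mul]
        calc _ ≤ V * (L * (φ (k + 1) ^ 2 * X k ω ^ 2)) :=
              mul_le_mul (hvV k) h (abs_nonneg _) hV0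
          _ = V * L * (φ (k + 1) ^ 2 * X k ω ^ 2) := by ring
          _ ≤ K * (φ (k + 1) ^ 2 * X k ω ^ 2) := by
              refine mul_le_mul_of_nonneg_right ?_ h2
              have : 0 ≤ α * (1 + V + V * |θ|) := by positivity
              linarith
      abs_v_le := hvV }

/-- A law gives only a.e.-measurability, whereas the filtration argument uses genuinely measurable
observations; modifying the noise on a null set leaves the moments unchanged. -/
lemma NoiseAssumption.exists_measurable {Ω : Type*} [MeasurableSpace Ω] {μ : Measure Ω}
    {σ : ℝ≥0} {d : ℕ → Ω → ℝ} (hd : NoiseAssumption μ σ d) :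
    ∃ d' : ℕ → Ω → ℝ, (∀ k, Measurable (d' k)) ∧ NoiseAssumption μ σ d' ∧
      ∀ᵐ ω ∂μ, ∀ k, d (k + 1) ω = d' (k + 1) ω := by
  have h : ∀ k, ∃ g : Ω → ℝ, Measurable g ∧ (1 ≤ k → d k =ᵐ[μ] g) := fun k => by
    by_cases hk : 1 ≤ k
    · obtain ⟨g, hg, hdg⟩ := (hd.law k hk).aemeasurable
      exact ⟨g, hg, fun _ => hdg⟩
    -- Index 0 carries no noise assumption and is never read by the algorithm.
    · exact ⟨0, measurable_zero, fun h => absurd h hk⟩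
  choose d' hm hae using h
  refine ⟨d', hm, ⟨?_, fun k hk => ⟨(hm k).aemeasurable, ?_⟩⟩,
    ae_all_iff.2 fun k => hae (k + 1) (by lia)⟩
  · exact (iIndepFun_congr fun k => hae (k + 1) (by lia)).1 hd.indep
  · rw [← Measure.map_congr (hae k hk), (hd.law k hk).map_eq]

end IMPF

end

theorem theorem3 {Ω : Type*} [MeasurableSpace Ω] (μ : Measure Ω) [IsProbabilityMeasure μ]
    (C : ℝ) (θ θbar : ℝ) (hθ : |θ| ≤ θbar)
    (σ : ℝ≥0) (hσ : 0 < σ) (d : ℕ → Ω → ℝ) (hd : IMPF.NoiseAssumption μ σ d)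
    (φ : ℕ → ℝ) (hφ : IMPF.InputAssumption φ)
    (θ₀ P₀ : ℝ) (hP₀ : 0 < P₀) :
    (∀ k : ℕ, Integrable (fun ω => (IMPF.estimate σ C θbar φ θ d θ₀ P₀ k ω - θ) ^ 2) μ) ∧
    Tendsto (fun k : ℕ => ∫ ω, (IMPF.estimate σ C θbar φ θ d θ₀ P₀ k ω - θ) ^ 2 ∂μ)
      atTop (𝓝 0) ∧
    (fun k : ℕ => ∫ ω, (IMPF.estimate σ C θbar φ θ d θ₀ P₀ k ω - θ) ^ 2 ∂μ)
      =O[atTop] (fun k : ℕ => 1 / (k : ℝ)) := by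
  obtain ⟨d', hdm, hd', hae⟩ := hd.exists_measurable
  have hcongr : ∀ k, (fun ω => (IMPF.estimate σ C θbar φ θ d θ₀ P₀ k ω - θ) ^ 2) =ᵐ[μ]
      fun ω => (IMPF.estimate σ C θbar φ θ d' θ₀ P₀ k ω - θ) ^ 2 := fun k => by
    filter_upwards [hae] with ω hω
    rw [IMPF.estimate, IMPF.run_congr σ C _ φ (s' := fun j => IMPF.observation C φ θ d' j ω)
      (fun j => by
        simp only [IMPF.observation, IMPF.output, hω]
        congr) θ₀ P₀ k, IMPF.estimate]
  obtain ⟨ℱ, Q, β, m, a, Z, q, b, B, c, K, V, H⟩ :=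
    IMPF.exists_recursiveError μ C hθ hσ hdm hd' hφ θ₀ hP₀
  obtain ⟨G, hG, hGb⟩ := H.exists_energy_mul_integral_sq_le (IMPF.tendsto_energy_atTop hφ)
  obtain ⟨r, hr, hrb⟩ := IMPF.exists_mul_le_energy hφ
  have hO : (fun k : ℕ => ∫ ω, (IMPF.estimate σ C θbar φ θ d θ₀ P₀ k ω - θ) ^ 2 ∂μ)
      =O[atTop] (fun k : ℕ => 1 / (k : ℝ)) := by
    refine IsBigO.of_bound (G / r) ((eventually_gt_atTop 0).mono fun k hk => ?_)
    have hk0 : (0 : ℝ) < k := by exact_mod_cast hk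
    have hI : 0 ≤ ∫ ω, (IMPF.estimate σ C θbar φ θ d' θ₀ P₀ k ω - θ) ^ 2 ∂μ :=
      integral_nonneg fun ω => sq_nonneg _
    rw [integral_congr_ae (hcongr k), Real.norm_of_nonneg hI, Real.norm_of_nonneg (by positivity),
      div_mul_div_comm, mul_one, le_div_iff₀ (by positivity), mul_comm]
    exact (mul_le_mul_of_nonneg_right (hrb k) hI).trans (hGb k)
  exact ⟨fun k => ((((H.bdd_X k).mono (H.sigma_le k)).pow 2).integrable μ).congr (hcongr k).symm,
    hO.trans_tendsto tendsto_one_div_atTop_nhds_zero_nat, hO⟩
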